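/- Let $n\in\mathbb N$, let $J=\begin{bmatrix}0&I_n\\-I_n&0\end{bmatrix}$, and let $\operatorname{Sp}(2n)$ be the group of real $2n\times 2n$ matrices $M$ with $M^TJM=J$. The symplectic orbit of a real $2n\times2n$ matrix $A$ is the set $\{M^TAM : M\in\operatorname{Sp}(2n)\}$. For a real symmetric positive definite $2n\times 2n$ matrix $B$, let $d(B)\in\mathbb R^n$ be the vector of its symplectic eigenvalues in non-decreasing order; that is, the $n$ diagonal entries (unique up to permutation) of a diagonal matrix $D\ge 0$ such that $M^TBM=\begin{bmatrix}D&0\\0&D\end{bmatrix}$ for some $M\in\operatorname{Sp}(2n)$. For a real symmetric positive definite $A=\begin{bmatrix}A_{11}&A_{12}\\A_{12}^T&A_{22}\end{bmatrix}$ with $n\times n$ blocks, let $\Delta_{11},\Delta_{12},\Delta_{22}\in\mathbb R^n$ be the diagonals of $A_{11},A_{12},A_{22}$ and define, with entrywise operations, $$\Delta_c(A)=\frac{\Delta_{11}+\Delta_{22}}2,\qquad \Delta_h(A)=\sqrt{\frac{\Delta_{11}^2+\Delta_{22}^2}2},\qquad \Delta_w(A)=\sqrt{\frac{\Delta_{11}^2+\Delta_{22}^2+2\Delta_{12}^2}2}.$$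 For $x\in\mathbb R^n$ let $x^\uparrow$ denote the vector of entries of $x$ rearranged in non-decreasing order. Let $A$ be a real symmetric positive definite $2n\times 2n$ matrix with $AJ=JA$, and let $\xi\in\{c,w,h\}$. Then every real symmetric positive definite $2n\times 2n$ matrix $B$ with $d(B)=\Delta_\xi(A)^\uparrow$ lies in the convex hull of the symplectic orbit of $A$. In particular, $\operatorname{diag}(\Delta_\xi(A))\oplus\operatorname{diag}(\Delta_\xi(A))$ lies in the convex hull of the symplectic orbit of $A$. -/

import Mathlib

open Matrix

noncomputable section

namespace SymplecticMajorization

/-- `Sp(2n)` is Mathlib's `Matrix.symplecticGroup (Fin n) ℝ`, for Mathlib's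
`Matrix.J = [0, -I; I, 0]`. The opposite sign convention for `J`, and the order
`Mᵀ J M = J` instead of `M J Mᵀ = J`, give the same set of matrices. -/
theorem mem_symplecticGroup_iff {n : ℕ} (M : Matrix (Fin n ⊕ Fin n) (Fin n ⊕ Fin n) ℝ) :
    M ∈ symplecticGroup (Fin n) ℝ ↔
      Mᵀ * fromBlocks 0 1 (-1) 0 * M = fromBlocks 0 1 (-1) 0 := by
  have h : (fromBlocks 0 1 (-1) 0 : Matrix (Fin n ⊕ Fin n) (Fin n ⊕ Fin n) ℝ)
      = -J (Fin n) ℝ := by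
    simp [J, fromBlocks_neg]
  rw [h, ← SymplecticGroup.transpose_mem_iff, SymplecticGroup.mem_iff, transpose_transpose]
  simp

/-- The symplectic orbit `{Mᵀ A M : M ∈ Sp(2n)}` of `A`. -/
def symplecticOrbit {n : ℕ} (A : Matrix (Fin n ⊕ Fin n) (Fin n ⊕ Fin n) ℝ) :
    Set (Matrix (Fin n ⊕ Fin n) (Fin n ⊕ Fin n) ℝ) :=
  {X | ∃ M ∈ symplecticGroup (Fin n) ℝ, X = Mᵀ * A * M}

/-- The `2n × 2n` matrix `diag(v) ⊕ diag(v)`. -/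
def diagSum {n : ℕ} (v : Fin n → ℝ) : Matrix (Fin n ⊕ Fin n) (Fin n ⊕ Fin n) ℝ :=
  fromBlocks (diagonal v) 0 0 (diagonal v)

/-- `d(A) = v`: the vector `v` lists the symplectic eigenvalues of `A` in non-decreasing order,
where the symplectic eigenvalues are the (non-negative) diagonal entries of `D` in a Williamson
decomposition `Mᵀ A M = D ⊕ D` with `M ∈ Sp(2n)`. There is at most one such `v`, see
`IsSymplecticSpectrum.unique`. -/
structure IsSymplecticSpectrum {n : ℕ} (A : Matrix (Fin n ⊕ Fin n) (Fin n ⊕ Fin n) ℝ)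
    (v : Fin n → ℝ) : Prop where
  nonneg : ∀ i, 0 ≤ v i
  monotone : Monotone v
  williamson : ∃ M ∈ symplecticGroup (Fin n) ℝ, Mᵀ * A * M = diagSum v

/-- `x↑`: the entries of `x` rearranged in non-decreasing order. -/
def sortUp {n : ℕ} (x : Fin n → ℝ) : Fin n → ℝ := x ∘ Tuple.sort x

/-- The labels of the three diagonal vectors below. -/
inductive DiagLabel
  | c
  | w
  | h

/-- The vectors `Δ_c(A)`, `Δ_w(A)`, `Δ_h(A)`, built entrywise from the diagonals of the
`n × n` blocks `A₁₁`, `A₁₂`, `A₂₂` of `A`. -/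
def Delta {n : ℕ} (A : Matrix (Fin n ⊕ Fin n) (Fin n ⊕ Fin n) ℝ) : DiagLabel → Fin n → ℝ
  | .c => fun i => (A.toBlocks₁₁ i i + A.toBlocks₂₂ i i) / 2
  | .w => fun i =>
      √((A.toBlocks₁₁ i i ^ 2 + A.toBlocks₂₂ i i ^ 2 + 2 * A.toBlocks₁₂ i i ^ 2) / 2)
  | .h => fun i => √((A.toBlocks₁₁ i i ^ 2 + A.toBlocks₂₂ i i ^ 2) / 2)

theorem IsSymplecticSpectrum.charpoly_roots {n : ℕ}
    {A : Matrix (Fin n ⊕ Fin n) (Fin n ⊕ Fin n) ℝ} {v : Fin n → ℝ}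
    (hv : IsSymplecticSpectrum A v) :
    ((J (Fin n) ℝ * A) * (J (Fin n) ℝ * A)).charpoly.roots
      = 2 • (Finset.univ.val.map fun i => -(v i) ^ 2) := by
  obtain ⟨M, hM, hD⟩ := hv.williamson
  have hM' : M * J (Fin n) ℝ * Mᵀ = J (Fin n) ℝ := SymplecticGroup.mem_iff.1 hM
  have hu : IsUnit M := (isUnit_iff_isUnit_det _).2 (SymplecticGroup.symplectic_det hM)
  obtain ⟨U, rfl⟩ := hu
  -- conjugation: `J A U = U J (Uᵀ A U)`
  have h1 : J (Fin n) ℝ * A = U.val * (J (Fin n) ℝ * diagSum v) * U⁻¹.val := by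
    rw [← hD]
    calc J (Fin n) ℝ * A = (U.val * J (Fin n) ℝ * U.valᵀ) * A * (U.val * U⁻¹.val) := by
          rw [hM']; simp
      _ = _ := by simp only [Matrix.mul_assoc]
  have h2 : (J (Fin n) ℝ * A) * (J (Fin n) ℝ * A)
      = U.val * ((J (Fin n) ℝ * diagSum v) * (J (Fin n) ℝ * diagSum v)) * U⁻¹.val := by
    have hc : U⁻¹.val * U.val = 1 := by simp
    rw [h1]
    calc _ = U.val * (J (Fin n) ℝ * diagSum v) * (U⁻¹.val * U.val)
            * (J (Fin n) ℝ * diagSum v) * U⁻¹.val := by simp only [Matrix.mul_assoc]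
      _ = _ := by rw [hc]; simp only [Matrix.mul_assoc, Matrix.one_mul]
  have h3 : (J (Fin n) ℝ * diagSum v) * (J (Fin n) ℝ * diagSum v)
      = diagonal (Sum.elim (fun i => -(v i) ^ 2) (fun i => -(v i) ^ 2)) := by
    simp [J, diagSum, fromBlocks_multiply, ← fromBlocks_diagonal, sq, ← diagonal_neg]
  have h4 := charpoly_units_conj U
    ((J (Fin n) ℝ * diagSum v) * (J (Fin n) ℝ * diagSum v))
  rw [← coe_units_inv] at h4
  rw [h2, h4, h3, charpoly_diagonal, Fintype.prod_sum_type]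
  simp only [Sum.elim_inl, Sum.elim_inr]
  rw [← sq, Polynomial.roots_pow]
  have h5 := Polynomial.roots_multiset_prod_X_sub_C
    (Finset.univ.val.map fun i => -(v i) ^ 2)
  rw [Multiset.map_map] at h5
  exact congrArg (fun s => 2 • s) h5

/-- The ordered vector of symplectic eigenvalues is unique. -/
theorem IsSymplecticSpectrum.unique {n : ℕ}
    {A : Matrix (Fin n ⊕ Fin n) (Fin n ⊕ Fin n) ℝ} {v w : Fin n → ℝ}
    (hv : IsSymplecticSpectrum A v) (hw : IsSymplecticSpectrum A w) : v = w := by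
  have h := hv.charpoly_roots.symm.trans hw.charpoly_roots
  have h' : (Finset.univ.val.map fun i => -(v i) ^ 2)
      = (Finset.univ.val.map fun i => -(w i) ^ 2) :=
    nsmul_right_injective (two_ne_zero) h
  have h4 := congrArg (Multiset.map fun x => √(-x)) h'
  simp only [Multiset.map_map, Function.comp_def, neg_neg, Real.sqrt_sq (hv.nonneg _),
    Real.sqrt_sq (hw.nonneg _)] at h4
  have h5 : List.ofFn v = List.ofFn w := by
    refine List.Perm.eq_of_pairwise' (r := (· ≤ ·)) ?_ ?_ ?_
    · exact hv.monotone.sortedLE_ofFn.pairwise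
    · exact hw.monotone.sortedLE_ofFn.pairwise
    · rw [← Multiset.coe_eq_coe]
      simpa [Fin.univ_val_map] using h4
  exact List.ofFn_injective h5

end SymplecticMajorization

end

open SymplecticMajorization

namespace SymplecticMajorization

section Blocks

variable {n : ℕ}

/-! Symmetry and commutation with `J` force `A₂₂ = A₁₁` and `A₁₂` skew, so the three vectors
coincide with the diagonal of `A₁₁` (`Delta_of_commute_J`). Averaging `A` over the symplectic sign
changes `diag(s) ⊕ diag(s)` kills the off-diagonal entries of every block
(`diagonal_blocks_mem_convexHull`), which puts `diagSum (Delta A ξ)` in the hull. The hull is stable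
under symplectic congruence, and `B` is congruent to this matrix: sort its entries by a permutation,
then undo the Williamson decomposition of `B`. -/

theorem fromBlocks_diag_mem_symplecticGroup {U : Matrix (Fin n) (Fin n) ℝ} (hU : U * Uᵀ = 1) :
    fromBlocks U 0 0 U ∈ symplecticGroup (Fin n) ℝ := by
  rw [SymplecticGroup.mem_iff]
  simp [J, fromBlocks_transpose, fromBlocks_multiply, hU]

theorem congr_mem_symplecticOrbit {A X N : Matrix (Fin n ⊕ Fin n) (Fin n ⊕ Fin n) ℝ}
    (hN : N ∈ symplecticGroup (Fin n) ℝ) (hX : X ∈ symplecticOrbit A) :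
    Nᵀ * X * N ∈ symplecticOrbit A := by
  obtain ⟨M, hM, rfl⟩ := hX
  exact ⟨M * N, mul_mem hM hN, by simp only [transpose_mul, Matrix.mul_assoc]⟩

/-- The convex hull of a symplectic orbit is stable under symplectic congruence. -/
theorem congr_mem_convexHull_symplecticOrbit
    {A X N : Matrix (Fin n ⊕ Fin n) (Fin n ⊕ Fin n) ℝ}
    (hN : N ∈ symplecticGroup (Fin n) ℝ) (hX : X ∈ convexHull ℝ (symplecticOrbit A)) :
    Nᵀ * X * N ∈ convexHull ℝ (symplecticOrbit A) := by
  let f : Matrix (Fin n ⊕ Fin n) (Fin n ⊕ Fin n) ℝ →ₗ[ℝ]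
      Matrix (Fin n ⊕ Fin n) (Fin n ⊕ Fin n) ℝ :=
    LinearMap.mulRight ℝ N ∘ₗ LinearMap.mulLeft ℝ Nᵀ
  have h : f X ∈ f '' convexHull ℝ (symplecticOrbit A) := ⟨X, hX, rfl⟩
  rw [f.image_convexHull] at h
  refine convexHull_mono ?_ h
  rintro _ ⟨Y, hY, rfl⟩
  exact congr_mem_symplecticOrbit hN hY

/-- Flipping the sign at `i` alone permutes the sign vectors and negates every summand. -/
theorem sum_signs_mul_signs {i j : Fin n} (hij : i ≠ j) :
    ∑ s : Fin n → ℤˣ, ((s i : ℤ) : ℝ) * ((s j : ℤ) : ℝ) = 0 := by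
  have h := Equiv.sum_comp (Equiv.mulLeft (Pi.mulSingle i (-1) : Fin n → ℤˣ))
    fun s : Fin n → ℤˣ => ((s i : ℤ) : ℝ) * ((s j : ℤ) : ℝ)
  simp [Pi.mulSingle_eq_of_ne hij.symm] at h
  linarith

/-- Averaging over the congruences by `diag(s) ⊕ diag(s)` with `s` a vector of signs replaces each
block by its diagonal. -/
theorem diagonal_blocks_mem_convexHull (A : Matrix (Fin n ⊕ Fin n) (Fin n ⊕ Fin n) ℝ) :
    fromBlocks (diagonal A.toBlocks₁₁.diag) (diagonal A.toBlocks₁₂.diag)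
      (diagonal A.toBlocks₂₁.diag) (diagonal A.toBlocks₂₂.diag)
        ∈ convexHull ℝ (symplecticOrbit A) := by
  let D : (Fin n → ℤˣ) → Matrix (Fin n) (Fin n) ℝ := fun s => diagonal fun i => ((s i : ℤ) : ℝ)
  let T : (Fin n → ℤˣ) → Matrix (Fin n ⊕ Fin n) (Fin n ⊕ Fin n) ℝ :=
    fun s => fromBlocks (D s) 0 0 (D s)
  have hsq (s : Fin n → ℤˣ) (i : Fin n) : ((s i : ℤ) : ℝ) * ((s i : ℤ) : ℝ) = 1 := by
    rw [← Int.cast_mul, Int.units_coe_mul_self, Int.cast_one]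
  have hT (s) : T s ∈ symplecticGroup (Fin n) ℝ :=
    fromBlocks_diag_mem_symplecticGroup (by simp [D, hsq])
  have hN : (Fintype.card (Fin n → ℤˣ) : ℝ) ≠ 0 := Nat.cast_ne_zero.2 Fintype.card_ne_zero
  have havg : ∑ s, (Fintype.card (Fin n → ℤˣ) : ℝ)⁻¹ • ((T s)ᵀ * A * T s)
      ∈ convexHull ℝ (symplecticOrbit A) :=
    (convex_convexHull ℝ _).sum_mem (fun _ _ => by positivity)
      (by rw [Finset.sum_const, Finset.card_univ, nsmul_eq_mul, mul_inv_cancel₀ hN])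
      fun s _ => subset_convexHull ℝ _ ⟨T s, hT s, rfl⟩
  -- Conjugation by `D s` multiplies entry `(i, j)` by `s i * s j`, whose mean over all `s` is `1`
  -- if `i = j` and `0` otherwise.
  have hpinch (P : Matrix (Fin n) (Fin n) ℝ) (i j : Fin n) :
      (Fintype.card (Fin n → ℤˣ) : ℝ)⁻¹ * ∑ s, (D s * P * D s) i j = diagonal P.diag i j := by
    have h (s) : (D s * P * D s) i j = P i j * (((s i : ℤ) : ℝ) * ((s j : ℤ) : ℝ)) := by
      simp only [D, mul_diagonal, diagonal_mul]; ring
    simp only [h, ← Finset.mul_sum]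
    rcases eq_or_ne i j with rfl | hij
    · simp only [hsq, Finset.sum_const, Finset.card_univ, nsmul_eq_mul, mul_one,
        diagonal_apply_eq, diag_apply]
      field_simp
    · rw [sum_signs_mul_signs hij, diagonal_apply_ne _ hij, mul_zero, mul_zero]
  have hblock (s) : (T s)ᵀ * A * T s = fromBlocks (D s * A.toBlocks₁₁ * D s)
      (D s * A.toBlocks₁₂ * D s) (D s * A.toBlocks₂₁ * D s) (D s * A.toBlocks₂₂ * D s) := by
    conv_lhs => rw [← fromBlocks_toBlocks A]
    simp [T, fromBlocks_transpose, fromBlocks_multiply, show (D s)ᵀ = D s from diagonal_transpose _]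
  convert havg using 1
  ext (i | i) (j | j) <;>
    simp only [Matrix.sum_apply, Matrix.smul_apply, smul_eq_mul, ← Finset.mul_sum, hblock, fromBlocks_apply₁₁,
      fromBlocks_apply₁₂, fromBlocks_apply₂₁, fromBlocks_apply₂₂, hpinch]

/-- Simultaneous permutation of both halves of the coordinates is symplectic. -/
theorem diagSum_comp_perm (v : Fin n → ℝ) (σ : Equiv.Perm (Fin n)) :
    ∃ M ∈ symplecticGroup (Fin n) ℝ, Mᵀ * diagSum v * M = diagSum (v ∘ σ) := by
  let P : Matrix (Fin n) (Fin n) ℝ := (1 : Matrix (Fin n) (Fin n) ℝ).submatrix id σ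
  have hmul (X : Matrix (Fin n) (Fin n) ℝ) : Pᵀ * X * P = X.submatrix σ σ := by
    have h1 : Pᵀ * X = X.submatrix σ id := by
      ext i j; simp [P, mul_apply, one_apply]
    rw [h1]
    ext i j; simp [P, mul_apply, one_apply]
  have hP : P * Pᵀ = 1 := by
    rw [mul_eq_one_comm]
    simpa using hmul 1
  refine ⟨_, fromBlocks_diag_mem_symplecticGroup hP, ?_⟩
  simp [diagSum, fromBlocks_transpose, fromBlocks_multiply, hmul, submatrix_diagonal_equiv,
    -fromBlocks_diagonal]

/-- If `A` is symmetric and commutes with `J` then `A₁₁ = A₂₂`, and `A₁₂` is skew-symmetric. -/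
theorem diag_blocks_of_commute_J {A : Matrix (Fin n ⊕ Fin n) (Fin n ⊕ Fin n) ℝ}
    (hA : A.IsSymm) (hAJ : A * J (Fin n) ℝ = J (Fin n) ℝ * A) :
    A.toBlocks₂₂ = A.toBlocks₁₁ ∧ A.toBlocks₁₂.diag = 0 ∧ A.toBlocks₂₁.diag = 0 := by
  rw [← fromBlocks_toBlocks A] at hAJ
  simp only [J, fromBlocks_multiply, fromBlocks_inj] at hAJ
  simp only [Matrix.mul_zero, Matrix.mul_one, Matrix.zero_mul, Matrix.one_mul, zero_add, add_zero,
    Matrix.mul_neg, Matrix.neg_mul] at hAJ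
  obtain ⟨h1, h2, -, -⟩ := hAJ
  -- Symmetry equates these diagonals, while `h1` says `A₁₂ = -A₂₁`; hence both vanish.
  have h3 (i) : A.toBlocks₁₂ i i = A.toBlocks₂₁ i i := (hA.apply (Sum.inl i) (Sum.inr i)).symm
  have h4 (i) : A.toBlocks₁₂ i i = 0 := by
    have := congrFun (congrFun h1 i) i
    rw [neg_apply, ← h3] at this
    linarith
  exact ⟨(neg_injective h2).symm, funext h4, funext fun i => (h3 i).symm.trans (h4 i)⟩

/-- Every mean of two equal numbers `a` is `a`; for the quadratic ones, `√(a ^ 2) = a` uses `0 ≤ a`,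
which comes from positive definiteness. -/
theorem Delta_of_commute_J {A : Matrix (Fin n ⊕ Fin n) (Fin n ⊕ Fin n) ℝ}
    (hA : A.PosDef) (hAJ : A * J (Fin n) ℝ = J (Fin n) ℝ * A) (ξ : DiagLabel) :
    Delta A ξ = A.toBlocks₁₁.diag := by
  obtain ⟨h1, h2, -⟩ := diag_blocks_of_commute_J (isHermitian_iff_isSymm.1 hA.1) hAJ
  ext i
  have h3 : A.toBlocks₁₂ i i = 0 := congrFun h2 i
  have h4 : 0 ≤ A.toBlocks₁₁ i i := hA.diag_pos.le
  cases ξ <;> simp [Delta, h1, h3, h4, ← two_mul]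

theorem diagSum_Delta_mem_convexHull {A : Matrix (Fin n ⊕ Fin n) (Fin n ⊕ Fin n) ℝ}
    (hA : A.PosDef) (hAJ : A * J (Fin n) ℝ = J (Fin n) ℝ * A) (ξ : DiagLabel) :
    diagSum (Delta A ξ) ∈ convexHull ℝ (symplecticOrbit A) := by
  obtain ⟨h1, h2, h3⟩ := diag_blocks_of_commute_J (isHermitian_iff_isSymm.1 hA.1) hAJ
  have h := diagonal_blocks_mem_convexHull A
  rw [h1, h2, h3] at h
  simpa [diagSum, Delta_of_commute_J hA hAJ] using h

end Blocks

end SymplecticMajorization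

theorem corollary3p4 (n : ℕ) (A : Matrix (Fin n ⊕ Fin n) (Fin n ⊕ Fin n) ℝ)
    (hA : A.PosDef) (hAJ : A * Matrix.J (Fin n) ℝ = Matrix.J (Fin n) ℝ * A)
    (ξ : SymplecticMajorization.DiagLabel) :
    (∀ B : Matrix (Fin n ⊕ Fin n) (Fin n ⊕ Fin n) ℝ, B.PosDef →
      SymplecticMajorization.IsSymplecticSpectrum B
        (SymplecticMajorization.sortUp (SymplecticMajorization.Delta A ξ)) →
      B ∈ convexHull ℝ (SymplecticMajorization.symplecticOrbit A)) ∧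
    SymplecticMajorization.diagSum (SymplecticMajorization.Delta A ξ) ∈
      convexHull ℝ (SymplecticMajorization.symplecticOrbit A) := by
  have hΔ := diagSum_Delta_mem_convexHull hA hAJ ξ
  refine ⟨fun B _ hBv => ?_, hΔ⟩
  obtain ⟨M, hM, hMB⟩ := hBv.williamson
  obtain ⟨S, hS, hSv⟩ := diagSum_comp_perm (Delta A ξ) (Tuple.sort (Delta A ξ))
  have hsort := congr_mem_convexHull_symplecticOrbit hS hΔ
  rw [hSv, ← sortUp, ← hMB] at hsort
  -- `Mᵀ * B * M` is now in the hull; congruence by the inverse of `M` recovers `B`.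
  have hinv := congr_mem_convexHull_symplecticOrbit
    ((⟨M, hM⟩ : symplecticGroup (Fin n) ℝ)⁻¹).2 hsort
  set N : Matrix (Fin n ⊕ Fin n) (Fin n ⊕ Fin n) ℝ :=
    ((⟨M, hM⟩ : symplecticGroup (Fin n) ℝ)⁻¹).1
  have hMN : M * N = 1 := congrArg Subtype.val (mul_inv_cancel (⟨M, hM⟩ : symplecticGroup (Fin n) ℝ))
  have hNM : Nᵀ * Mᵀ = 1 := by rw [← transpose_mul, hMN, transpose_one]
  have hB : Nᵀ * (Mᵀ * B * M) * N = B := by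
    calc Nᵀ * (Mᵀ * B * M) * N = Nᵀ * Mᵀ * B * (M * N) := by simp only [Matrix.mul_assoc]
      _ = B := by rw [hNM, hMN, Matrix.one_mul, Matrix.mul_one]
  rwa [hB] at hinv
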